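/- Let $n\ge 1$, let $S\subseteq\mathbb{R}^n$ be discrete (every bounded subset of $S$ is finite) and let $k\in\mathbb{N}_0$. Let $c(S,k)$ be the quantitative Helly number: the smallest $t\in\mathbb{N}_0$ such that, whenever convex sets $C_1,\dots,C_m\subseteq\mathbb{R}^n$ ($m\ge1$) have exactly $k$ points of $S$ in common, there is a set $I\subseteq\{1,\dots,m\}$ with $|I|\le t$ such that the sets $C_i$, $i\in I$, already have exactly $k$ points of $S$ in common (the intersection of the empty family being $\mathbb{R}^n$). Put $c(S,k)=\infty$ if no such $t$ exists, and $c(S,k)=-\infty$ if no convex set contains exactly $k$ points of $S$. Let $\mathcal{M}(S,k)$ be the family of all $n$-dimensional convex sets $M\subseteq\mathbb{R}^n$ with $|\operatorname{int}(M)\cap S|=k$ such that $M=M'$ for every convex set $M'\supseteq M$ with $\operatorname{int}(M')\cap S=\operatorname{int}(M)\cap S$. For a polyhedron $M$ (the intersection of finitely many closed halfspaces) let $\operatorname{fct}(M)$ be the set of its facets, i.e. its non-empty faces of dimension $\dim(M)-1$; if $M$ is not a polyhedron, put $|\operatorname{fct}(M)|=\infty$. Then $$c(S,k)=\max\{\,|\operatorname{fct}(M)|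 : M\in\mathcal{M}(S,k)\,\},$$ where the maximum is taken in $\{-\infty\}\cup\mathbb{N}_0\cup\{\infty\}$ in the extended sense, that is, as a supremum: it is $-\infty$ if $\mathcal{M}(S,k)=\emptyset$, and $\infty$ if the numbers $|\operatorname{fct}(M)|$ are unbounded. If $c(S,k)$ is a (finite) number in $\mathbb{N}_0$, then the maximum is attained by some $M\in\mathcal{M}(S,k)$. In particular, if $c(S,k)<\infty$, then every $M\in\mathcal{M}(S,k)$ is a polyhedron. -/

import Mathlib

/-- A subset of `ℝⁿ` is called discrete if each of its bounded subsets is finite. -/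
def IsDiscreteSubset {n : ℕ} (S : Set (EuclideanSpace ℝ (Fin n))) : Prop :=
  ∀ B : Set (EuclideanSpace ℝ (Fin n)), B ⊆ S → Bornology.IsBounded B → B.Finite

/-- The property that the quantitative Helly number minimises over `t`: whenever convex sets
`C₁, …, C_m` (`m ≥ 1`) have exactly `k` points of `S` in common, some at most `t` of them already
have exactly `k` points of `S` in common. The intersection of the empty subfamily is `ℝⁿ`. -/
def HellyProperty {n : ℕ} (S : Set (EuclideanSpace ℝ (Fin n))) (k t : ℕ) : Prop :=
  ∀ (m : ℕ) (C : Fin m → Set (EuclideanSpace ℝ (Fin n))), 1 ≤ m →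
    (∀ i, Convex ℝ (C i)) → (S ∩ ⋂ i, C i).encard = k →
      ∃ I : Finset (Fin m), I.card ≤ t ∧ (S ∩ ⋂ i ∈ I, C i).encard = k

open Classical in
/-- The quantitative Helly number `c(S, k)`, with values in `{-∞} ∪ ℕ₀ ∪ {∞}`: it is `-∞` (`⊥`) if no
convex set contains exactly `k` points of `S`; otherwise it is the smallest `t` with
`HellyProperty S k t`, and `∞` (`⊤`, the infimum of the empty set) if there is no such `t`. -/
noncomputable def quantHelly {n : ℕ} (S : Set (EuclideanSpace ℝ (Fin n))) (k : ℕ) : WithBot ℕ∞ :=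
  if ∃ C : Set (EuclideanSpace ℝ (Fin n)), Convex ℝ C ∧ (S ∩ C).encard = k then
    ((sInf ((fun t : ℕ => (t : ℕ∞)) '' {t : ℕ | HellyProperty S k t}) : ℕ∞) : WithBot ℕ∞)
  else ⊥

/-- `𝓜(S, k)`: the inclusion-maximal `n`-dimensional convex sets with exactly `k` points of `S` in
the interior. -/
structure IsMaximalConvex {n : ℕ} (S : Set (EuclideanSpace ℝ (Fin n))) (k : ℕ)
    (M : Set (EuclideanSpace ℝ (Fin n))) : Prop where
  convex : Convex ℝ M
  full_dim : affineSpan ℝ M = ⊤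
  card_interior : (interior M ∩ S).encard = k
  maximal : ∀ M' : Set (EuclideanSpace ℝ (Fin n)), Convex ℝ M' → M ⊆ M' →
    interior M' ∩ S = interior M ∩ S → M = M'

/-- A polyhedron: the solution set of a finite (possibly empty) system of linear inequalities. -/
def IsPolyhedron {n : ℕ} (P : Set (EuclideanSpace ℝ (Fin n))) : Prop :=
  ∃ (m : ℕ) (a : Fin m → EuclideanSpace ℝ (Fin n)) (b : Fin m → ℝ),
    P = {x | ∀ i, inner ℝ (a i) x ≤ b i}

/-- `F` is a facet of the polyhedron `P`: a non-empty face (set of maximisers over `P` of a linear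
functional) with `dim F = dim P - 1`. -/
structure IsFacet {n : ℕ} (P F : Set (EuclideanSpace ℝ (Fin n))) : Prop where
  nonempty : F.Nonempty
  face : IsExposed ℝ P F
  dim : Module.finrank ℝ (vectorSpan ℝ F) + 1 = Module.finrank ℝ (vectorSpan ℝ P)

open Classical in
/-- The number of facets, read as `∞` for a set that is not a polyhedron. -/
noncomputable def numFacets {n : ℕ} (M : Set (EuclideanSpace ℝ (Fin n))) : ℕ∞ :=
  if IsPolyhedron M then {F | IsFacet M F}.encard else ⊤

/-!
Both inequalities between the Helly number and the numbers of facets come from comparing convex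
sets with systems of linear inequalities.

*Facets are bounded by the Helly number.* Let the Helly property hold with parameter `t` and let
`M ∈ 𝓜(S, k)`. Inside a ball of radius `R`, only finitely many points of `S` lie outside
`interior M`, and each is cut off by an open halfspace around `interior M`. By the Helly property,
`t` of these halfspaces suffice. As `R → ∞`, compactness of the normalized halfspace data yields `t`
closed halfspaces whose intersection `Q ⊇ M` has no further points of `S` in its interior, so
`Q = M` by maximality (`IsMaximalConvex.exists_description`). Hence `M` is a polyhedron, and it has
at most `t` facets (`encard_setOf_isFacet_le`).

*The Helly number is bounded by facets.* Let a family of convex sets with exactly the set `K` of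
points of `S` in common be irredundant. The sets that consist of all points of `S` in their convex
hull form a convex geometry, in which a closed proper subset of a finite closed set can be enlarged
by a single point (`IsHullClosed.exists_insert`). Enlarging the members of the family as long as
their intersection remains `K` leads to points `w i ∈ S`, one for each member, such that the convex
hull of `K` and all `w i` contains no other points of `S`, and each `w i` is a vertex of it
(`IsDiscreteSubset.exists_vertices`). The convex hull of `K` and the midpoints of all pairs
`w i, w j` then avoids the `w i`, so by Zorn's lemma it lies in the interior of some `M ∈ 𝓜(S, k)`
that has the points `K` of `S` in its interior (`IsDiscreteSubset.exists_isMaximalConvex`). If `M` is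
a polyhedron, every `w i` violates the strict form of one of its facet inequalities, and two of them
never violate the same one, since their midpoint is interior. So `M` has at least as many facets as
the family has members.
-/

/-! ### Polyhedra and their facets -/

theorem vectorSpan_eq_top_of_affineSpan_eq_top {E : Type*} [NormedAddCommGroup E]
    [NormedSpace ℝ E] {M : Set E} (h : affineSpan ℝ M = ⊤) : vectorSpan ℝ M = ⊤ := by
  rw [← direction_affineSpan, h, AffineSubspace.direction_top]

/-- A nonzero linear functional bounded above on a set is strictly below the bound in the
interior. -/
theorem inner_lt_of_mem_interior {E : Type*} [NormedAddCommGroup E] [InnerProductSpace ℝ E]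
    {M : Set E} {a : E} {b : ℝ} (ha : a ≠ 0) (hM : ∀ x ∈ M, inner ℝ a x ≤ b) {x : E}
    (hx : x ∈ interior M) : inner ℝ a x < b := by
  have hc : Continuous fun ε : ℝ => x + ε • a := by fun_prop
  have h0 : ∀ᶠ ε in nhds (0 : ℝ), x + ε • a ∈ M := by
    refine hc.continuousAt.eventually_mem ?_
    simpa using mem_interior_iff_mem_nhds.1 hx
  obtain ⟨δ, hδ, hball⟩ := Metric.eventually_nhds_iff.1 h0
  have h1 := hM _ (hball (y := δ / 2) (by
    rw [Real.dist_eq, sub_zero, abs_of_pos (by positivity)]; linarith))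
  rw [inner_add_right, inner_smul_right, real_inner_self_eq_norm_sq] at h1
  have : 0 < ‖a‖ := norm_pos_iff.2 ha
  have : 0 < δ / 2 * ‖a‖ ^ 2 := by positivity
  linarith

theorem isOpen_setOf_forall_inner_lt {E ι : Type*} [NormedAddCommGroup E] [InnerProductSpace ℝ E]
    [Finite ι] (a : ι → E) (b : ι → ℝ) : IsOpen {x : E | ∀ i, inner ℝ (a i) x < b i} := by
  rw [Set.ofPred_forall]
  exact isOpen_iInter_of_finite fun i => isOpen_lt (by fun_prop) continuous_const

/-- If no inequality of a finite system is tight on all of a convex set of solutions, then some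
point of the set satisfies all of them strictly. -/
theorem Convex.exists_forall_inner_lt {E ι : Type*} [NormedAddCommGroup E] [InnerProductSpace ℝ E]
    {F : Set E} (hF : Convex ℝ F) (hne : F.Nonempty) (a : ι → E) (b : ι → ℝ) (J : Finset ι)
    (hle : ∀ x ∈ F, ∀ i ∈ J, inner ℝ (a i) x ≤ b i)
    (hlt : ∀ i ∈ J, ∃ x ∈ F, inner ℝ (a i) x < b i) :
    ∃ x ∈ F, ∀ i ∈ J, inner ℝ (a i) x < b i := by
  classical
  induction J using Finset.induction_on with
  | empty => exact ⟨hne.some, hne.some_mem, by simp⟩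
  | insert j J hj ih =>
    obtain ⟨x, hxF, hx⟩ := ih (fun x hx i hi => hle x hx i (Finset.mem_insert_of_mem hi))
      (fun i hi => hlt i (Finset.mem_insert_of_mem hi))
    obtain ⟨z, hzF, hz⟩ := hlt j (Finset.mem_insert_self _ _)
    refine ⟨midpoint ℝ x z, hF.midpoint_mem hxF hzF, fun i hi => ?_⟩
    rw [midpoint_eq_smul_add, inner_smul_right, inner_add_right, invOf_eq_inv]
    have h1 := hle x hxF i hi
    have h2 := hle z hzF i hi
    rcases Finset.mem_insert.1 hi with rfl | hi
    · linarith
    · have := hx i hi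
      linarith

theorem finrank_orthogonal_singleton_add_one {E : Type*} [NormedAddCommGroup E]
    [InnerProductSpace ℝ E] [FiniteDimensional ℝ E] {a : E} (ha : a ≠ 0) :
    Module.finrank ℝ (ℝ ∙ a)ᗮ + 1 = Module.finrank ℝ E := by
  have := Submodule.finrank_add_finrank_orthogonal (ℝ ∙ a)
  rw [finrank_span_singleton ha] at this
  omega

/-- Every facet of a full-dimensional polyhedron is cut out by turning one of the defining
inequalities into an equation. -/
theorem IsFacet.exists_eq {n t : ℕ} {a : Fin t → EuclideanSpace ℝ (Fin n)} {b : Fin t → ℝ}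
    {M F : Set (EuclideanSpace ℝ (Fin n))} (hM : M = {x | ∀ i, inner ℝ (a i) x ≤ b i})
    (hdim : affineSpan ℝ M = ⊤) (hF : IsFacet M F) :
    ∃ i, F = {x ∈ M | inner ℝ (a i) x = b i} := by
  classical
  obtain ⟨l, hl⟩ := hF.face hF.nonempty
  have hFM : F ⊆ M := fun x hx => by rw [hl] at hx; exact hx.1
  have hMconv : Convex ℝ M := by
    rw [hM, Set.ofPred_forall]
    exact convex_iInter fun i => convex_halfSpace_le (innerSL ℝ (a i)).toLinearMap.isLinear _
  have hFconv : Convex ℝ F := hF.face.convex hMconv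
  obtain ⟨x₀, hx₀⟩ := hF.nonempty
  have hxl : ∀ x, x ∈ F ↔ x ∈ M ∧ l x = l x₀ := fun x => by
    have h₀ := hx₀
    rw [hl] at h₀ ⊢
    exact ⟨fun h => ⟨h.1, le_antisymm (h₀.2 x h.1) (h.2 x₀ h₀.1)⟩,
      fun h => ⟨h.1, fun y hy => h.2 ▸ h₀.2 y hy⟩⟩
  have hrank := hF.dim
  rw [vectorSpan_eq_top_of_affineSpan_eq_top hdim, finrank_top] at hrank
  have hl0 : l ≠ 0 := by
    rintro rfl
    have : F = M := by ext x; simp [hxl]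
    rw [this, vectorSpan_eq_top_of_affineSpan_eq_top hdim, finrank_top] at hrank
    omega
  -- Otherwise `l` would attain its maximum at an interior point of `M`.
  have hex : ∃ i, a i ≠ 0 ∧ ∀ x ∈ F, inner ℝ (a i) x = b i := by
    by_contra! hcon
    obtain ⟨x, hxF, hx⟩ := hFconv.exists_forall_inner_lt hF.nonempty a b
      (Finset.univ.filter fun i => a i ≠ 0)
      (fun x hx i _ => by have := hFM hx; rw [hM] at this; exact this i)
      (fun i hi => by
        obtain ⟨x, hx, hne⟩ := hcon i (by simpa using hi)
        have := hFM hx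
        rw [hM] at this
        exact ⟨x, hx, lt_of_le_of_ne (this i) hne⟩)
    have hxint : x ∈ interior M := by
      refine mem_interior.2 ⟨{y | ∀ i : {i // a i ≠ 0}, inner ℝ (a i) y < b i}, ?_,
        isOpen_setOf_forall_inner_lt (fun i : {i // a i ≠ 0} => a i) (fun i => b i), ?_⟩
      · intro y hy
        rw [hM]
        intro i
        by_cases hi : a i = 0
        · have := hFM hxF
          rw [hM] at this
          simpa [hi] using this i
        · exact (hy ⟨i, hi⟩).le
      · exact fun i => hx i (by simpa using i.2)
    have hlx := hxF
    rw [hl] at hlx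
    have hne : (InnerProductSpace.toDual ℝ _).symm l ≠ 0 := by simpa using hl0
    have := inner_lt_of_mem_interior (b := l x) hne (fun y hy => by
      rw [InnerProductSpace.toDual_symm_apply]; exact hlx.2 y hy) hxint
    rw [InnerProductSpace.toDual_symm_apply] at this
    exact lt_irrefl _ this
  obtain ⟨i, hai, hi⟩ := hex
  -- `F` spans the direction of the hyperplane `⟪a i, x⟫ = b i`, so `l` is a multiple of `⟪a i, ·⟫`.
  have hsub : vectorSpan ℝ F ≤ (ℝ ∙ a i)ᗮ := by
    rw [vectorSpan_def, Submodule.span_le]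
    rintro _ ⟨x, hx, y, hy, rfl⟩
    rw [SetLike.mem_coe, Submodule.mem_orthogonal_singleton_iff_inner_right]
    change inner ℝ (a i) (x - y) = 0
    rw [inner_sub_right, hi x hx, hi y hy, sub_self]
  have heq : vectorSpan ℝ F = (ℝ ∙ a i)ᗮ := by
    refine Submodule.eq_of_le_of_finrank_eq hsub ?_
    have := finrank_orthogonal_singleton_add_one hai
    omega
  have hlF : vectorSpan ℝ F ≤ LinearMap.ker l.toLinearMap := by
    rw [vectorSpan_def, Submodule.span_le]
    rintro _ ⟨x, hx, y, hy, rfl⟩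
    simp [((hxl x).1 hx).2, ((hxl y).1 hy).2]
  refine ⟨i, Set.Subset.antisymm (fun x hx => ⟨hFM hx, hi x hx⟩) fun x hx => (hxl x).2 ⟨hx.1, ?_⟩⟩
  have : x - x₀ ∈ (ℝ ∙ a i)ᗮ := by
    rw [Submodule.mem_orthogonal_singleton_iff_inner_right, inner_sub_right, hx.2, hi x₀ hx₀,
      sub_self]
  rw [← heq] at this
  have := hlF this
  simpa [sub_eq_zero] using this

theorem encard_setOf_isFacet_le {n t : ℕ} {a : Fin t → EuclideanSpace ℝ (Fin n)} {b : Fin t → ℝ}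
    {M : Set (EuclideanSpace ℝ (Fin n))} (hM : M = {x | ∀ i, inner ℝ (a i) x ≤ b i})
    (hdim : affineSpan ℝ M = ⊤) : {F | IsFacet M F}.encard ≤ t := by
  have hsub : {F | IsFacet M F} ⊆
      (fun i => {x ∈ M | inner ℝ (a i) x = b i}) '' (Set.univ : Set (Fin t)) := by
    intro F hF
    obtain ⟨i, hi⟩ := hF.exists_eq hM hdim
    exact ⟨i, Set.mem_univ i, hi.symm⟩
  calc _ ≤ _ := Set.encard_le_encard hsub
    _ ≤ (Set.univ : Set (Fin t)).encard := Set.encard_image_le _ _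
    _ = t := by simp

/-- If `p` lies in `M`, satisfies one defining inequality with equality and all the others
strictly, then that inequality defines a facet. -/
theorem isFacet_of_mem {n N : ℕ} {a : Fin N → EuclideanSpace ℝ (Fin n)} {b : Fin N → ℝ}
    {M : Set (EuclideanSpace ℝ (Fin n))} (hM : M = {x | ∀ i, inner ℝ (a i) x ≤ b i})
    (hdim : affineSpan ℝ M = ⊤) {i : Fin N} (hai : a i ≠ 0) {p : EuclideanSpace ℝ (Fin n)}
    (hpi : inner ℝ (a i) p = b i) (hp : ∀ j, j ≠ i → inner ℝ (a j) p < b j) :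
    IsFacet M {x ∈ M | inner ℝ (a i) x = b i} := by
  have hle : ∀ x ∈ M, inner ℝ (a i) x ≤ b i := fun x hx => by rw [hM] at hx; exact hx i
  have hpM : p ∈ M := by
    rw [hM]
    intro j
    by_cases hj : j = i
    · subst hj; exact hpi.le
    · exact (hp j hj).le
  refine ⟨⟨p, hpM, hpi⟩, fun _ => ⟨innerSL ℝ (a i), ?_⟩, ?_⟩
  · ext x
    simp only [Set.mem_sep_iff, innerSL_apply_apply, and_congr_right_iff]
    intro hx
    exact ⟨fun h y hy => h ▸ hle y hy, fun h => le_antisymm (hle x hx) (hpi ▸ h p hpM)⟩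
  · have : vectorSpan ℝ {x ∈ M | inner ℝ (a i) x = b i} = (ℝ ∙ a i)ᗮ := by
      refine le_antisymm ?_ ?_
      · rw [vectorSpan_def, Submodule.span_le]
        rintro _ ⟨x, hx, y, hy, rfl⟩
        rw [SetLike.mem_coe, Submodule.mem_orthogonal_singleton_iff_inner_right]
        change inner ℝ (a i) (x - y) = 0
        rw [inner_sub_right, hx.2, hy.2, sub_self]
      · intro v hv
        rw [Submodule.mem_orthogonal_singleton_iff_inner_right] at hv
        -- A short step from `p` in the direction `v` stays in the facet.
        have hc : Continuous fun ε : ℝ => p + ε • v := by fun_prop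
        have h0 : ∀ᶠ ε in nhds (0 : ℝ),
            p + ε • v ∈ {x | ∀ j : {j // j ≠ i}, inner ℝ (a j) x < b j} := by
          refine hc.continuousAt.eventually_mem ((isOpen_setOf_forall_inner_lt
            (fun j : {j // j ≠ i} => a j) (fun j => b j)).mem_nhds ?_)
          intro j
          simpa using hp j j.2
        obtain ⟨δ, hδ, hball⟩ := Metric.eventually_nhds_iff.1 h0
        have h1 := hball (y := δ / 2) (by
          rw [Real.dist_eq, sub_zero, abs_of_pos (by positivity)]; linarith)
        have h2 : inner ℝ (a i) (p + (δ / 2) • v) = b i := by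
          rw [inner_add_right, inner_smul_right, hv, hpi]; ring
        have h3 : p + (δ / 2) • v ∈ M := by
          rw [hM]
          intro j
          by_cases hj : j = i
          · subst hj; exact h2.le
          · exact (h1 ⟨j, hj⟩).le
        have h4 := vsub_mem_vectorSpan ℝ (s := {x ∈ M | inner ℝ (a i) x = b i})
          ⟨h3, h2⟩ ⟨hpM, hpi⟩
        rw [vsub_eq_sub, add_sub_cancel_left] at h4
        have h5 := Submodule.smul_mem _ (δ / 2)⁻¹ h4
        rwa [inv_smul_smul₀ (by positivity)] at h5
    rw [this, vectorSpan_eq_top_of_affineSpan_eq_top hdim, finrank_top,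
      finrank_orthogonal_singleton_add_one hai]

/-- A full-dimensional polyhedron is described by at most as many inequalities as it has facets:
in a description with the fewest inequalities, each of them defines a facet of its own. -/
theorem IsPolyhedron.exists_description {n : ℕ} {M : Set (EuclideanSpace ℝ (Fin n))}
    (h : IsPolyhedron M) (hdim : affineSpan ℝ M = ⊤) (hint : (interior M).Nonempty) :
    ∃ (N : ℕ) (a : Fin N → EuclideanSpace ℝ (Fin n)) (b : Fin N → ℝ),
      (∀ x, x ∈ interior M ↔ ∀ i, inner ℝ (a i) x < b i) ∧
      (N : ℕ∞) ≤ {F | IsFacet M F}.encard := by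
  classical
  obtain ⟨a, b, hM⟩ := Nat.find_spec h
  have hmin := fun m => Nat.find_min h (m := m)
  generalize Nat.find h = N at a b hM hmin
  obtain ⟨c, hc⟩ := hint
  have hcM : ∀ i, inner ℝ (a i) c ≤ b i := by
    have := interior_subset hc
    rw [hM] at this
    exact this
  have hz : ∀ i, ∃ z, b i < inner ℝ (a i) z ∧ ∀ j, j ≠ i → inner ℝ (a j) z ≤ b j := by
    intro i
    obtain _ | N := N
    · exact i.elim0
    by_contra! hcon
    refine hmin N (Nat.lt_succ_self N) ⟨fun j => a (i.succAbove j), fun j => b (i.succAbove j), ?_⟩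
    rw [hM]
    ext x
    refine ⟨fun hx j => hx _, fun hx => ?_⟩
    have hx' : ∀ j, j ≠ i → inner ℝ (a j) x ≤ b j := fun j hj => by
      obtain ⟨j', rfl⟩ := Fin.exists_succAbove_eq hj
      exact hx j'
    intro j
    by_cases hj : j = i
    · subst hj
      by_contra! hlt
      obtain ⟨j', hj', hlt'⟩ := hcon x hlt
      exact absurd (hx' j' hj') (not_le.2 hlt')
    · exact hx' j hj
  have ha : ∀ i, a i ≠ 0 := by
    intro i hi
    obtain ⟨z, hz, -⟩ := hz i
    have := hcM i
    rw [hi, inner_zero_left] at hz this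
    linarith
  have hintM : ∀ x, x ∈ interior M ↔ ∀ i, inner ℝ (a i) x < b i := by
    intro x
    refine ⟨fun hx i => inner_lt_of_mem_interior (ha i) (fun y hy => ?_) hx, fun hx => ?_⟩
    · rw [hM] at hy; exact hy i
    · refine mem_interior.2 ⟨_, ?_, isOpen_setOf_forall_inner_lt a b, hx⟩
      rw [hM]
      exact fun y hy i => (hy i).le
  -- The segment from the interior point `c` to `z` leaves `M` through the facet numbered `i`.
  have hp : ∀ i, ∃ p, inner ℝ (a i) p = b i ∧ ∀ j, j ≠ i → inner ℝ (a j) p < b j := by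
    intro i
    obtain ⟨z, hzi, hzj⟩ := hz i
    have hcs := (hintM c).1 hc
    set u := inner ℝ (a i) z - b i with hu
    set v := b i - inner ℝ (a i) c with hv
    have hupos : 0 < u := by linarith
    have hvpos : 0 < v := by linarith [hcs i]
    have huv : u + v ≠ 0 := by positivity
    refine ⟨(u / (u + v)) • c + (v / (u + v)) • z, ?_, fun j hj => ?_⟩
    · rw [inner_add_right, inner_smul_right, inner_smul_right]
      field_simp
      rw [hu, hv]
      ring
    · rw [inner_add_right, inner_smul_right, inner_smul_right]
      have h1 : u / (u + v) * inner ℝ (a j) c < u / (u + v) * b j :=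
        mul_lt_mul_of_pos_left (hcs j) (by positivity)
      have h2 : v / (u + v) * inner ℝ (a j) z ≤ v / (u + v) * b j :=
        mul_le_mul_of_nonneg_left (hzj j hj) (by positivity)
      have h3 : u / (u + v) * b j + v / (u + v) * b j = b j := by field_simp
      linarith
  refine ⟨N, a, b, hintM, ?_⟩
  have hinj : Function.Injective fun i => {x ∈ M | inner ℝ (a i) x = b i} := by
    intro i j hij
    by_contra hne
    obtain ⟨p, hpi, hpj⟩ := hp i
    have hpM : p ∈ M := by
      rw [hM]
      intro l
      by_cases hl : l = i
      · subst hl; exact hpi.le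
      · exact (hpj l hl).le
    have : p ∈ {x ∈ M | inner ℝ (a i) x = b i} := ⟨hpM, hpi⟩
    have hij' : {x ∈ M | inner ℝ (a i) x = b i} = {x ∈ M | inner ℝ (a j) x = b j} := hij
    rw [hij'] at this
    exact absurd this.2 (hpj j (Ne.symm hne)).ne
  calc (N : ℕ∞) = (Set.univ : Set (Fin N)).encard := by simp
    _ = ((fun i => {x ∈ M | inner ℝ (a i) x = b i}) '' Set.univ).encard := (hinj.encard_image _).symm
    _ ≤ _ := by
      refine Set.encard_le_encard ?_
      rintro _ ⟨i, -, rfl⟩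
      obtain ⟨p, hpi, hpj⟩ := hp i
      exact isFacet_of_mem hM hdim (ha i) hpi hpj

/-! ### Discrete sets and hull-closed subsets -/

theorem IsDiscreteSubset.isClosed_of_subset {n : ℕ} {S T : Set (EuclideanSpace ℝ (Fin n))}
    (hS : IsDiscreteSubset S) (hT : T ⊆ S) : IsClosed T := by
  refine isClosed_of_closure_subset fun x hx => ?_
  have hfin : (Metric.ball x 1 ∩ T).Finite :=
    hS _ (Set.inter_subset_right.trans hT) (Metric.isBounded_ball.subset Set.inter_subset_left)
  have := Metric.isOpen_ball.inter_closure ⟨Metric.mem_ball_self one_pos, hx⟩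
  rw [hfin.isClosed.closure_eq] at this
  exact this.2

theorem IsDiscreteSubset.exists_notMem {n : ℕ} (hn : 1 ≤ n) {S : Set (EuclideanSpace ℝ (Fin n))}
    (hS : IsDiscreteSubset S) : ∃ x, x ∉ S := by
  have : Nonempty (Fin n) := ⟨⟨0, hn⟩⟩
  by_contra! h
  have hfin : (Metric.ball (0 : EuclideanSpace ℝ (Fin n)) 1).Finite :=
    hS _ (fun x _ => h x) Metric.isBounded_ball
  have := Module.punctured_nhds_neBot ℝ (EuclideanSpace ℝ (Fin n)) 0
  exact infinite_of_mem_nhds 0 (Metric.ball_mem_nhds _ one_pos) hfin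

/-- `A` is hull-closed in `S` if it consists of all points of `S` in its convex hull. These sets are
the closed sets of a convex geometry on `S`. -/
def IsHullClosed {E : Type*} [AddCommGroup E] [Module ℝ E] (S A : Set E) : Prop :=
  S ∩ convexHull ℝ A = A

theorem IsHullClosed.subset {E : Type*} [AddCommGroup E] [Module ℝ E] {S A : Set E}
    (h : IsHullClosed S A) : A ⊆ S := by
  rw [← h]; exact Set.inter_subset_left

theorem Convex.isHullClosed_inter {E : Type*} [AddCommGroup E] [Module ℝ E] {S C : Set E}
    (hC : Convex ℝ C) : IsHullClosed S (S ∩ C) :=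
  Set.Subset.antisymm
    (fun _ hx => ⟨hx.1, convexHull_min Set.inter_subset_right hC hx.2⟩)
    (fun _ hx => ⟨hx.1, subset_convexHull ℝ _ hx⟩)

/-- A finite set not contained in the convex hull of `A` has a vertex outside `A`. -/
theorem Set.Finite.exists_notMem_convexHull_diff {E : Type*} [NormedAddCommGroup E]
    [NormedSpace ℝ E] {A B : Set E} (hB : B.Finite) (h : ¬ B ⊆ convexHull ℝ A) :
    ∃ v ∈ B, v ∉ A ∧ v ∉ convexHull ℝ (B \ {v}) := by
  by_contra! hcon
  refine h ?_
  have hext : (convexHull ℝ B).extremePoints ℝ ⊆ B := extremePoints_convexHull_subset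
  have hextA : (convexHull ℝ B).extremePoints ℝ ⊆ A := by
    intro v hv
    by_contra hvA
    have h1 := hcon v (hext hv) hvA
    rw [(convex_convexHull ℝ B).mem_extremePoints_iff_mem_sdiff_convexHull_sdiff] at hv
    exact hv.2 (convexHull_mono (Set.sdiff_subset_sdiff_left (subset_convexHull ℝ B)) h1)
  have hKM := closure_convexHull_extremePoints (hB.isCompact_convexHull ℝ) (convex_convexHull ℝ B)
  rw [((hB.subset hext).isClosed_convexHull ℝ).closure_eq] at hKM
  exact (subset_convexHull ℝ B).trans (hKM ▸ convexHull_mono hextA)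

/-- Hull-closed sets form a convex geometry: a hull-closed proper subset of a finite hull-closed set
can be enlarged by a single point. -/
theorem IsHullClosed.exists_insert {E : Type*} [NormedAddCommGroup E] [NormedSpace ℝ E]
    {S A W : Set E} (hA : IsHullClosed S A) (hW : IsHullClosed S W) (hfin : W.Finite)
    (hAW : A ⊂ W) : ∃ w ∈ W, w ∉ A ∧ IsHullClosed S (insert w A) := by
  -- A smallest hull-closed set strictly between exceeds `A` by one point only.
  obtain ⟨B, ⟨hB, hAB, hBW⟩, hmin⟩ := WellFounded.has_min (measure (Set.ncard (α := E))).wf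
    {B | IsHullClosed S B ∧ A ⊂ B ∧ B ⊆ W} ⟨W, hW, hAW, subset_rfl⟩
  have hBfin := hfin.subset hBW
  obtain ⟨v, hvB, hvA, hv⟩ := hBfin.exists_notMem_convexHull_diff (A := A) (B := B) (by
    intro h
    exact hAB.not_subset fun x hx => by
      have : x ∈ S ∩ convexHull ℝ A := ⟨hB.subset hx, h hx⟩
      rwa [hA] at this)
  have hclosed : IsHullClosed S (B \ {v}) := by
    refine Set.Subset.antisymm (fun x hx => ⟨?_, ?_⟩)
      fun x hx => ⟨hB.subset hx.1, subset_convexHull ℝ _ hx⟩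
    · rw [← hB]
      exact ⟨hx.1, convexHull_mono Set.sdiff_subset hx.2⟩
    · rintro rfl
      exact hv hx.2
  have hABv : A ⊆ B \ {v} := fun x hx => ⟨hAB.subset hx, fun h => hvA (h ▸ hx)⟩
  have heq : A = B \ {v} := by
    by_contra hne
    refine hmin (B \ {v}) ⟨hclosed, hABv.ssubset_of_ne hne, Set.sdiff_subset.trans hBW⟩ ?_
    exact Set.ncard_sdiff_singleton_lt_of_mem hvB hBfin
  refine ⟨v, hBW hvB, hvA, ?_⟩
  rwa [heq, Set.insert_sdiff_singleton, Set.insert_eq_of_mem hvB]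

/-- An irredundant family of convex sets with common `S`-points `K` yields equally many points of
`S` that are vertices of their joint convex hull with `K`, where this hull has no further points
of `S`. -/
theorem IsDiscreteSubset.exists_vertices {n : ℕ} {S K : Set (EuclideanSpace ℝ (Fin n))}
    (hS : IsDiscreteSubset S) {ι : Type*} [Fintype ι] {C : ι → Set (EuclideanSpace ℝ (Fin n))}
    (hC : ∀ i, Convex ℝ (C i)) (hK : K.Finite) (hKC : S ∩ ⋂ i, C i = K)
    {y : ι → EuclideanSpace ℝ (Fin n)} (hyS : ∀ i, y i ∈ S) (hyC : ∀ i j, y i ∈ C j ↔ j ≠ i) :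
    ∃ w : ι → EuclideanSpace ℝ (Fin n), Function.Injective w ∧ (∀ i, w i ∈ S ∧ w i ∉ K) ∧
      S ∩ convexHull ℝ (K ∪ Set.range w) ⊆ K ∪ Set.range w ∧
      ∀ i, w i ∉ convexHull ℝ ((K ∪ Set.range w) \ {w i}) := by
  classical
  set D := convexHull ℝ (K ∪ Set.range y) with hD
  set W := S ∩ D with hWdef
  have hW : IsHullClosed S W := (convex_convexHull ℝ _).isHullClosed_inter
  have hWfin : W.Finite := hS _ Set.inter_subset_left
    (((hK.union (Set.finite_range y)).isCompact_convexHull ℝ).isBounded.subset Set.inter_subset_right)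
  have hKW : K ⊆ W := fun x hx =>
    ⟨by rw [← hKC] at hx; exact hx.1, subset_convexHull ℝ _ (Or.inl hx)⟩
  have hyW : ∀ i, y i ∈ W := fun i => ⟨hyS i, subset_convexHull ℝ _ (Or.inr ⟨i, rfl⟩)⟩
  -- Among the irredundant families of hull-closed subsets of `W` with intersection `K`, one with
  -- the largest members is chosen.
  obtain ⟨A, ⟨hAc, hAW, hAK, z, hzW, hzA⟩, hmin⟩ := WellFounded.has_min
    (measure fun A : ι → Set (EuclideanSpace ℝ (Fin n)) => ∑ i, (W \ A i).ncard).wf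
    {A | (∀ i, IsHullClosed S (A i)) ∧ (∀ i, A i ⊆ W) ∧ (∀ x ∈ W, (∀ i, x ∈ A i) ↔ x ∈ K) ∧
      ∃ z : ι → EuclideanSpace ℝ (Fin n), (∀ i, z i ∈ W) ∧ ∀ i j, z i ∈ A j ↔ j ≠ i} (by
    refine ⟨fun i => S ∩ (C i ∩ D), fun i =>
      ((hC i).inter (convex_convexHull ℝ _)).isHullClosed_inter,
      fun i x hx => ⟨hx.1, hx.2.2⟩, fun x hx => ?_, y, hyW, fun i j => ?_⟩
    · rw [← hKC]
      exact ⟨fun h => ⟨hx.1, Set.mem_iInter.2 fun i => (h i).2.1⟩,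
        fun h i => ⟨hx.1, Set.mem_iInter.1 h.2 i, hx.2⟩⟩
    · rw [← hyC]
      exact ⟨fun h => h.2.1, fun h => ⟨hyS i, h, (hyW i).2⟩⟩)
  have hw : ∀ i, ∃ w ∈ W, w ∉ A i ∧ IsHullClosed S (insert w (A i)) := fun i =>
    (hAc i).exists_insert hW hWfin ((hAW i).ssubset_of_ne fun h =>
      (hzA i i).1 (h ▸ hzW i) rfl)
  choose w hwW hwA hwc using hw
  have hwmem : ∀ i j, j ≠ i → w i ∈ A j := by
    intro i j hji
    by_contra hwj
    -- Otherwise the larger set `insert (w i) (A i)` could replace `A i`.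
    refine hmin (Function.update A i (insert (w i) (A i))) ⟨fun l => ?_, fun l => ?_, fun x hx => ?_,
      z, hzW, fun l l' => ?_⟩ ?_
    · by_cases hl : l = i
      · subst hl; simpa using hwc l
      · simpa [hl] using hAc l
    · by_cases hl : l = i
      · subst hl; simpa using Set.insert_subset (hwW l) (hAW l)
      · simpa [hl] using hAW l
    · rw [← hAK x hx]
      refine ⟨fun h l => ?_, fun h l => ?_⟩
      · have hl' := h l
        by_cases hl : l = i
        · subst hl
          rw [Function.update_self] at hl'
          rcases hl' with rfl | hl'
          · exact absurd (by simpa [hji] using h j) hwj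
          · exact hl'
        · simpa [hl] using hl'
      · by_cases hl : l = i
        · subst hl; simpa using Or.inr (h l)
        · simpa [hl] using h l
    · rw [← hzA l l']
      by_cases hl : l' = i
      · subst hl
        rw [Function.update_self]
        refine ⟨fun h => h.resolve_left fun h => ?_, fun h => Or.inr h⟩
        by_cases hll : l' = l
        · subst hll
          exact hwj (h ▸ (hzA l' j).2 hji)
        · exact hwA l' (h ▸ (hzA l l').2 hll)
      · simp [hl]
    · change ∑ l, (W \ Function.update A i (insert (w i) (A i)) l).ncard < ∑ l, (W \ A l).ncard
      refine Finset.sum_lt_sum (fun l _ => ?_) ⟨i, Finset.mem_univ i, ?_⟩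
      · refine Set.ncard_le_ncard (Set.sdiff_subset_sdiff_right ?_) (hWfin.subset Set.sdiff_subset)
        by_cases hl : l = i
        · subst hl; simp
        · simp [hl]
      · refine Set.ncard_lt_ncard ?_ (hWfin.subset Set.sdiff_subset)
        refine Set.ssubset_iff_of_subset (Set.sdiff_subset_sdiff_right (by simp)) |>.2
          ⟨w i, ⟨hwW i, hwA i⟩, by simp⟩
  have hwK : ∀ i, w i ∉ K := fun i h => hwA i ((hAK _ (hwW i)).2 h i)
  have hgen : ∀ i, K ∪ Set.range w ⊆ insert (w i) (A i) := by
    rintro i x (hx | ⟨j, rfl⟩)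
    · exact Or.inr ((hAK x (hKW hx)).2 hx i)
    · by_cases hj : i = j
      · exact Or.inl (hj ▸ rfl)
      · exact Or.inr (hwmem j i hj)
  refine ⟨w, fun i j hij => ?_, fun i => ⟨(hwW i).1, hwK i⟩, fun x hx => ?_, fun i hi => ?_⟩
  · by_contra hne
    exact hwA j (hij ▸ hwmem i j (Ne.symm hne))
  · by_contra hcon
    have hxA : ∀ i, x ∈ A i := fun i => by
      have : x ∈ S ∩ convexHull ℝ (insert (w i) (A i)) := ⟨hx.1, convexHull_mono (hgen i) hx.2⟩
      rw [hwc i] at this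
      exact this.resolve_left fun h => hcon (Or.inr ⟨i, h.symm⟩)
    refine hcon (Or.inl ((hAK x ⟨hx.1, ?_⟩).1 hxA))
    refine convexHull_min ?_ (convex_convexHull ℝ _) hx.2
    rintro u (hu | ⟨j, rfl⟩)
    · exact (hKW hu).2
    · exact (hwW j).2
  · have hsub : (K ∪ Set.range w) \ {w i} ⊆ A i := fun x hx =>
      (hgen i hx.1).resolve_left hx.2
    have : w i ∈ S ∩ convexHull ℝ (A i) := ⟨(hwW i).1, convexHull_mono hsub hi⟩
    rw [hAc i] at this
    exact hwA i this

/-! ### Maximal convex sets -/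

theorem IsMaximalConvex.interior_nonempty {n : ℕ} {S M : Set (EuclideanSpace ℝ (Fin n))} {k : ℕ}
    (h : IsMaximalConvex S k M) : (interior M).Nonempty :=
  h.convex.interior_nonempty_iff_affineSpan_eq_top.2 h.full_dim

/-- A compact convex set with exactly `k` points of `S` lies in the interior of a member of
`𝓜(S, k)` whose interior has the same points of `S`. -/
theorem IsDiscreteSubset.exists_isMaximalConvex {n : ℕ} (hn : 1 ≤ n)
    {S Q : Set (EuclideanSpace ℝ (Fin n))} (hS : IsDiscreteSubset S) {k : ℕ} (hQ : IsCompact Q)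
    (hQc : Convex ℝ Q) (hk : (S ∩ Q).encard = k) :
    ∃ M, IsMaximalConvex S k M ∧ Q ⊆ interior M ∧ interior M ∩ S = S ∩ Q := by
  wlog hne : Q.Nonempty generalizing Q
  · -- The empty set is replaced by a point outside `S`.
    rw [Set.not_nonempty_iff_eq_empty] at hne
    obtain ⟨x, hx⟩ := hS.exists_notMem hn
    have hempty : S ∩ {x} = ∅ := by simpa using hx
    subst hne
    rw [Set.inter_empty] at hk ⊢
    obtain ⟨M, hM, -, hMS⟩ := this (Q := {x}) isCompact_singleton (convex_singleton x)
      (by rw [hempty, hk]) (Set.singleton_nonempty x)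
    exact ⟨M, hM, Set.empty_subset _, by rw [hMS, hempty]⟩
  have hcl : IsClosed (S \ Q) := hS.isClosed_of_subset Set.sdiff_subset
  obtain ⟨δ, hδ, hδQ⟩ := hQ.exists_thickening_subset_open hcl.isOpen_compl
    (fun x hx h => h.2 hx)
  -- The interiors of convex sets are the open convex sets, and these are stable under unions of
  -- chains.
  obtain ⟨O, hUO, hO⟩ := zorn_subset_nonempty
    {O : Set (EuclideanSpace ℝ (Fin n)) | IsOpen O ∧ Convex ℝ O ∧ O ∩ S ⊆ Q}
    (by
      intro c hc hchain hcne
      refine ⟨⋃₀ c, ⟨isOpen_sUnion fun s hs => (hc hs).1,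
        hchain.directedOn.convex_sUnion fun s hs => (hc hs).2.1, ?_⟩,
        fun s hs => Set.subset_sUnion_of_mem hs⟩
      rintro x ⟨⟨s, hs, hxs⟩, hxS⟩
      exact (hc hs).2.2 ⟨hxs, hxS⟩)
    (Metric.thickening δ Q)
    ⟨Metric.isOpen_thickening, hQc.thickening δ, fun x hx => by
      by_contra h
      exact hδQ hx.1 ⟨hx.2, h⟩⟩
  obtain ⟨hOo, hOc, hOS⟩ := hO.prop
  have hQO : Q ⊆ O := (Metric.self_subset_thickening hδ Q).trans hUO
  have hintO : (interior O).Nonempty := by rw [hOo.interior_eq]; exact hne.mono hQO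
  have hint : interior (closure O) = O := by
    rw [hOc.interior_closure_eq_interior_of_nonempty_interior hintO, hOo.interior_eq]
  have hOSQ : O ∩ S = S ∩ Q :=
    Set.Subset.antisymm (fun x hx => ⟨hx.2, hOS hx⟩) (fun x hx => ⟨hQO hx.2, hx.1⟩)
  refine ⟨closure O, ⟨hOc.closure, ?_, ?_, fun M' hM' hsub hM'S => ?_⟩, ?_, ?_⟩
  · rw [← hOc.closure.interior_nonempty_iff_affineSpan_eq_top, hint]
    exact hne.mono hQO
  · rw [hint, hOSQ, hk]
  · have hOM' : O ⊆ interior M' := by rw [← hint]; exact interior_mono hsub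
    have hM'O : interior M' ⊆ O := by
      refine hO.le_of_ge ⟨isOpen_interior, hM'.interior, ?_⟩ hOM'
      rw [hM'S, hint]
      exact hOS
    refine Set.Subset.antisymm hsub ?_
    calc M' ⊆ closure M' := subset_closure
      _ = closure (interior M') := (hM'.closure_interior_eq_closure_of_nonempty_interior
          ((hne.mono hQO).mono hOM')).symm
      _ ⊆ closure O := closure_mono hM'O
  · rw [hint]; exact hQO
  · rw [hint, hOSQ]

/-! ### Bounding the Helly number by the number of facets -/

/-- An irredundant family of convex sets having `k` points of `S` in common has at most as many
members as some set in `𝓜(S, k)` has facets. -/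
theorem IsDiscreteSubset.exists_card_le_numFacets {n : ℕ} (hn : 1 ≤ n)
    {S : Set (EuclideanSpace ℝ (Fin n))} (hS : IsDiscreteSubset S) {k : ℕ} {ι : Type*} [Fintype ι]
    {C : ι → Set (EuclideanSpace ℝ (Fin n))} (hC : ∀ i, Convex ℝ (C i))
    (hk : (S ∩ ⋂ i, C i).encard = k) {y : ι → EuclideanSpace ℝ (Fin n)} (hyS : ∀ i, y i ∈ S)
    (hyC : ∀ i j, y i ∈ C j ↔ j ≠ i) :
    ∃ M, IsMaximalConvex S k M ∧ (Fintype.card ι : ℕ∞) ≤ numFacets M := by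
  classical
  set K := S ∩ ⋂ i, C i with hKdef
  have hK : K.Finite := Set.finite_of_encard_eq_coe hk
  obtain ⟨w, hwinj, hwS, hwh, hwv⟩ := hS.exists_vertices hC hK rfl hyS hyC
  set G := K ∪ {x | ∃ i j, i ≠ j ∧ x = midpoint ℝ (w i) (w j)} with hG
  have hGfin : G.Finite := by
    refine hK.union ((Set.finite_range fun p : ι × ι => midpoint ℝ (w p.1) (w p.2)).subset ?_)
    rintro x ⟨i, j, -, rfl⟩
    exact ⟨(i, j), rfl⟩
  have hGsub : G ⊆ convexHull ℝ (K ∪ Set.range w) := by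
    rintro x (hx | ⟨i, j, -, rfl⟩)
    · exact subset_convexHull ℝ _ (Or.inl hx)
    · exact (convex_convexHull ℝ _).midpoint_mem
        (subset_convexHull ℝ _ (Or.inr ⟨i, rfl⟩)) (subset_convexHull ℝ _ (Or.inr ⟨j, rfl⟩))
  -- A functional exposing the vertex `w i` keeps it away from `K` and from all midpoints.
  have hwG : ∀ i, w i ∉ convexHull ℝ G := by
    intro i hi
    have hfin : ((K ∪ Set.range w) \ {w i}).Finite :=
      (hK.union (Set.finite_range w)).subset Set.sdiff_subset
    obtain ⟨f, u, hfu, huf⟩ := geometric_hahn_banach_closed_point (convex_convexHull ℝ _)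
      (hfin.isClosed_convexHull ℝ) (hwv i)
    have hlt : ∀ x ∈ K ∪ Set.range w, x ≠ w i → f x < f (w i) := fun x hx hne =>
      (hfu x (subset_convexHull ℝ _ ⟨hx, hne⟩)).trans huf
    have hle : ∀ j, f (w j) ≤ f (w i) := fun j => by
      by_cases h : w j = w i
      · rw [h]
      · exact (hlt _ (Or.inr ⟨j, rfl⟩) h).le
    have hsub : convexHull ℝ G ⊆ {x | f x < f (w i)} := by
      refine convexHull_min ?_ (convex_halfSpace_lt f.toLinearMap.isLinear _)
      rintro x (hx | ⟨j, l, hjl, rfl⟩)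
      · exact hlt x (Or.inl hx) fun h => (hwS i).2 (h ▸ hx)
      · have hmid : f (midpoint ℝ (w j) (w l)) = (f (w j) + f (w l)) / 2 := by
          rw [midpoint_eq_smul_add, map_smul, map_add, invOf_eq_inv, smul_eq_mul]
          ring
        rw [Set.mem_ofPred_eq, hmid]
        have hj := hle j
        have hl := hle l
        by_cases h : w j = w i
        · have := hlt (w l) (Or.inr ⟨l, rfl⟩) fun h' => hjl (hwinj (h.trans h'.symm))
          linarith
        · have := hlt (w j) (Or.inr ⟨j, rfl⟩) h
          linarith
    exact lt_irrefl (f (w i)) (hsub hi)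
  have hSG : S ∩ convexHull ℝ G = K := by
    refine Set.Subset.antisymm (fun x hx => ?_)
      fun x hx => ⟨hx.1, subset_convexHull ℝ _ (Or.inl hx)⟩
    rcases hwh ⟨hx.1, convexHull_min hGsub (convex_convexHull ℝ _) hx.2⟩ with h | ⟨i, rfl⟩
    · exact h
    · exact absurd hx.2 (hwG i)
  obtain ⟨M, hM, hGM, hMS⟩ := hS.exists_isMaximalConvex hn (hGfin.isCompact_convexHull ℝ)
    (convex_convexHull ℝ G) (by rw [hSG, hk])
  refine ⟨M, hM, ?_⟩
  rw [numFacets]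
  split_ifs with hpoly
  swap
  · exact le_top
  obtain ⟨N, a, b, hint, hN⟩ := hpoly.exists_description hM.full_dim hM.interior_nonempty
  have hviol : ∀ i, ∃ j, b j ≤ inner ℝ (a j) (w i) := by
    intro i
    by_contra! h
    have : w i ∈ interior M ∩ S := ⟨(hint _).2 h, (hwS i).1⟩
    rw [hMS, hSG] at this
    exact (hwS i).2 this
  choose g hg using hviol
  -- Two of the points cannot violate the same inequality, because their midpoint is interior.
  have hginj : Function.Injective g := by
    intro i j hij
    by_contra hne
    have hmid := (hint _).1 (hGM (subset_convexHull ℝ _ (Or.inr ⟨i, j, hne, rfl⟩))) (g i)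
    rw [midpoint_eq_smul_add, inner_smul_right, inner_add_right, invOf_eq_inv] at hmid
    have h1 := hg i
    have h2 := hg j
    rw [← hij] at h2
    linarith
  refine le_trans ?_ hN
  have := Fintype.card_le_of_injective g hginj
  rw [Fintype.card_fin] at this
  exact_mod_cast this

/-- The Helly property with parameter `t` holds once all sets in `𝓜(S, k)` have at most `t`
facets. -/
theorem IsDiscreteSubset.hellyProperty {n : ℕ} (hn : 1 ≤ n) {S : Set (EuclideanSpace ℝ (Fin n))}
    (hS : IsDiscreteSubset S) {k t : ℕ} (ht : ∀ M, IsMaximalConvex S k M → numFacets M ≤ t) :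
    HellyProperty S k t := by
  classical
  intro m C _ hC hk
  obtain ⟨I, hI, hmin⟩ := WellFounded.has_min (measure (Finset.card (α := Fin m))).wf
    {I | (S ∩ ⋂ i ∈ I, C i).encard = k} ⟨Finset.univ, by simpa using hk⟩
  refine ⟨I, ?_, hI⟩
  have hI' : (S ∩ ⋂ i : I, C i).encard = k := by
    rw [← hI, Set.iInter_subtype (fun i => i ∈ I) fun i => C i]
  -- By minimality of `I`, each of its sets excludes a point of `S` that the others contain.
  have hy : ∀ i : I, ∃ y ∈ S, ∀ j : I, y ∈ C j ↔ j ≠ i := by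
    intro i
    by_contra! hcon
    refine hmin (I.erase i) ?_ (Finset.card_erase_lt_of_mem i.2)
    rw [Set.mem_ofPred_eq, ← hI]
    congr 1
    refine Set.Subset.antisymm (fun x hx => ⟨hx.1, ?_⟩) fun x hx => ⟨hx.1, ?_⟩
    · have hxj : ∀ j : I, j ≠ i → x ∈ C j := fun j hj =>
        Set.mem_iInter₂.1 hx.2 j (Finset.mem_erase.2 ⟨fun h => hj (Subtype.ext h), j.2⟩)
      have hxi : x ∈ C i := by
        by_contra hxi
        obtain ⟨j, hj⟩ := hcon x hx.1
        by_cases hji : j = i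
        · subst hji; simp [hxi] at hj
        · simp [hji, hxj j hji] at hj
      refine Set.mem_iInter₂.2 fun j hj => ?_
      by_cases hji : (⟨j, hj⟩ : I) = i
      · rw [← hji] at hxi; exact hxi
      · exact hxj ⟨j, hj⟩ hji
    · exact Set.mem_iInter₂.2 fun j hj => Set.mem_iInter₂.1 hx.2 j (Finset.mem_of_mem_erase hj)
  choose y hyS hyC using hy
  obtain ⟨M, hM, hle⟩ := hS.exists_card_le_numFacets hn (fun i : I => hC i) hI' hyS hyC
  have := hle.trans (ht M hM)
  rw [Fintype.card_coe] at this
  exact_mod_cast this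

/-! ### Bounding the number of facets by the Helly number -/

theorem HellyProperty.exists_finset {n : ℕ} {S : Set (EuclideanSpace ℝ (Fin n))} {k t : ℕ}
    (h : HellyProperty S k t) {ι : Type*} [Fintype ι] [Nonempty ι]
    {C : ι → Set (EuclideanSpace ℝ (Fin n))} (hC : ∀ i, Convex ℝ (C i))
    (hk : (S ∩ ⋂ i, C i).encard = k) :
    ∃ I : Finset ι, I.card ≤ t ∧ (S ∩ ⋂ i ∈ I, C i).encard = k := by
  classical
  obtain ⟨I, hI, hIk⟩ := h (Fintype.card ι) (fun i => C ((Fintype.equivFin ι).symm i))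
    Fintype.card_pos (fun i => hC _) (by
      rwa [(Fintype.equivFin ι).symm.surjective.iInter_comp])
  refine ⟨I.map (Fintype.equivFin ι).symm.toEmbedding, by simpa using hI, ?_⟩
  rw [← hIk]
  congr 2
  ext x
  simp only [Finset.mem_map_equiv, Equiv.symm_symm, Set.mem_iInter]
  exact (Fintype.equivFin ι).forall_congr fun i => by simp

theorem Finset.exists_fin_option_cover {α : Type*} (J : Finset α) {t : ℕ} (h : J.card ≤ t) :
    ∃ g : Fin t → Option α, ∀ s ∈ J, ∃ i, g i = some s := by
  classical
  refine ⟨fun i => if hi : (i : ℕ) < J.card then some (J.equivFin.symm ⟨i, hi⟩) else none,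
    fun s hs => ⟨⟨J.equivFin ⟨s, hs⟩, (J.equivFin ⟨s, hs⟩).2.trans_le h⟩, ?_⟩⟩
  simp

/-- A nonempty open convex set is separated from an outside point by an open halfspace
`⟪a, ·⟫ < b` whose data `(a, b)` are normalized. -/
theorem Convex.exists_normalized_halfSpace {E : Type*} [NormedAddCommGroup E]
    [InnerProductSpace ℝ E] [CompleteSpace E] {U : Set E} (hU : Convex ℝ U) (hUo : IsOpen U)
    (hne : U.Nonempty) {s : E} (hs : s ∉ U) :
    ∃ p : E × ℝ, ‖p‖ = 1 ∧ (∀ x ∈ U, inner ℝ p.1 x < p.2) ∧ p.2 ≤ inner ℝ p.1 s := by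
  obtain ⟨f, hf⟩ := geometric_hahn_banach_open_point hU hUo hs
  set a := (InnerProductSpace.toDual ℝ E).symm f with ha
  have hfa : ∀ x, inner ℝ a x = f x := fun x => InnerProductSpace.toDual_symm_apply
  have hq : ((a, f s) : E × ℝ) ≠ 0 := by
    intro h
    rw [Prod.mk_eq_zero] at h
    obtain ⟨c, hc⟩ := hne
    have := hf c hc
    rw [← hfa, h.1, h.2, inner_zero_left] at this
    exact lt_irrefl _ this
  have hr : 0 < ‖((a, f s) : E × ℝ)‖⁻¹ := inv_pos.2 (norm_pos_iff.2 hq)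
  refine ⟨‖((a, f s) : E × ℝ)‖⁻¹ • (a, f s), ?_, fun x hx => ?_, ?_⟩
  · rw [norm_smul, norm_inv, norm_norm, inv_mul_cancel₀ (norm_ne_zero_iff.2 hq)]
  · rw [Prod.smul_fst, Prod.smul_snd, real_inner_smul_left, hfa, smul_eq_mul]
    exact mul_lt_mul_of_pos_left (hf x hx) hr
  · rw [Prod.smul_fst, Prod.smul_snd, real_inner_smul_left, hfa, smul_eq_mul]

/-- Within a large ball, at most `t` open halfspaces around `interior M` cut out the points of `S`
in `interior M`. A halfspace `⟪a, ·⟫ < b` is encoded by the pair `(a, b)`, normalized to norm one;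
the pair `(0, 1)` stands for the whole space and fills up the list. -/
theorem HellyProperty.exists_halfSpaces {n : ℕ} {S M : Set (EuclideanSpace ℝ (Fin n))}
    (hS : IsDiscreteSubset S) {k t : ℕ} (h : HellyProperty S k t) (hM : Convex ℝ M)
    (hne : (interior M).Nonempty) (hk : (interior M ∩ S).encard = k) {R : ℝ}
    (hR : interior M ∩ S ⊆ Metric.closedBall 0 R) :
    ∃ p : Fin t → EuclideanSpace ℝ (Fin n) × ℝ,
      (∀ i, ‖p i‖ = 1 ∧ ∀ x ∈ interior M, inner ℝ (p i).1 x < (p i).2) ∧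
      ∀ x ∈ S, ‖x‖ ≤ R → (∀ i, inner ℝ (p i).1 x < (p i).2) → x ∈ interior M := by
  classical
  have hTfin : ((S \ interior M) ∩ Metric.closedBall 0 R).Finite :=
    hS _ (fun x hx => hx.1.1) (Metric.isBounded_closedBall.subset Set.inter_subset_right)
  set T := (S \ interior M) ∩ Metric.closedBall 0 R with hT
  have : Fintype T := hTfin.fintype
  choose q hq1 hqM hqs using fun s : T =>
    hM.interior.exists_normalized_halfSpace isOpen_interior hne s.2.1.2
  let C : Option T → Set (EuclideanSpace ℝ (Fin n)) := fun o =>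
    o.elim (Metric.closedBall 0 R) fun s => {x | inner ℝ (q s).1 x < (q s).2}
  have hC : ∀ o, Convex ℝ (C o) := by
    rintro (_ | s)
    · exact convex_closedBall _ _
    · exact convex_halfSpace_lt (innerSL ℝ (q s).1).toLinearMap.isLinear _
  have hsub : ∀ o, interior M ∩ S ⊆ C o := by
    rintro (_ | s)
    · exact hR
    · exact fun x hx => hqM s x hx.1
  have hCk : S ∩ ⋂ o, C o = interior M ∩ S := by
    refine Set.Subset.antisymm (fun x hx => ⟨?_, hx.1⟩)
      fun x hx => ⟨hx.2, Set.mem_iInter.2 fun o => hsub o hx⟩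
    by_contra hxM
    have hx0 := Set.mem_iInter.1 hx.2 none
    have hxs := Set.mem_iInter.1 hx.2 (some ⟨x, ⟨hx.1, hxM⟩, hx0⟩)
    exact absurd (hqs ⟨x, ⟨hx.1, hxM⟩, hx0⟩) (not_le.2 hxs)
  obtain ⟨I, hIt, hIk⟩ := h.exists_finset hC (by rw [hCk, hk])
  have hIeq : interior M ∩ S = S ∩ ⋂ o ∈ I, C o := by
    refine (Set.finite_of_encard_eq_coe hk).eq_of_subset_of_encard_le
      (fun x hx => ⟨hx.2, Set.mem_iInter₂.2 fun o _ => hsub o hx⟩) ?_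
    rw [hIk, hk]
  obtain ⟨g, hg⟩ := I.eraseNone.exists_fin_option_cover
    ((Finset.card_eraseNone_le _).trans hIt)
  refine ⟨fun i => (g i).elim (0, 1) q, fun i => ?_, fun x hxS hxR hx => ?_⟩
  · dsimp only
    cases g i with
    | none => simp
    | some s => exact ⟨hq1 s, hqM s⟩
  · have : x ∈ interior M ∩ S := by
      rw [hIeq]
      refine ⟨hxS, Set.mem_iInter₂.2 ?_⟩
      rintro (_ | s) hs
      · exact mem_closedBall_zero_iff.2 hxR
      · obtain ⟨i, hi⟩ := hg s (Finset.mem_eraseNone.2 hs)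
        have := hx i
        dsimp only at this
        rw [hi] at this
        exact this
    exact this.1

/-- If the Helly property holds with parameter `t`, then every set in `𝓜(S, k)` is the solution set
of `t` linear inequalities, obtained as a limit of the halfspaces for balls of growing radius. -/
theorem IsMaximalConvex.exists_description {n : ℕ} {S M : Set (EuclideanSpace ℝ (Fin n))}
    (hS : IsDiscreteSubset S) {k t : ℕ} (h : HellyProperty S k t) (hM : IsMaximalConvex S k M) :
    ∃ (a : Fin t → EuclideanSpace ℝ (Fin n)) (b : Fin t → ℝ),
      M = {x | ∀ i, inner ℝ (a i) x ≤ b i} := by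
  have hne := hM.interior_nonempty
  obtain ⟨R₀, hR₀⟩ := (Set.finite_of_encard_eq_coe hM.card_interior).isBounded.subset_closedBall 0
  choose p hp1 hp2 using fun R : ℕ => h.exists_halfSpaces hS hM.convex hne hM.card_interior
    (R := R₀ + R) (hR₀.trans (Metric.closedBall_subset_closedBall (by simp)))
  have hlim : ∀ i, ∃ q ∈ Metric.sphere (0 : EuclideanSpace ℝ (Fin n) × ℝ) 1,
      Filter.Tendsto (fun R => p R i) (Filter.hyperfilter ℕ) (nhds q) := fun i =>
    (isCompact_sphere _ _).ultrafilter_le_nhds ((Filter.hyperfilter ℕ).map fun R => p R i)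
      (Filter.le_principal_iff.2 (Filter.mem_map.2 (Filter.univ_mem' fun R => by
        simpa using (hp1 R i).1)))
  choose q hq1 hq using hlim
  have hinner : ∀ i x, Filter.Tendsto (fun R => inner ℝ (p R i).1 x) (Filter.hyperfilter ℕ)
      (nhds (inner ℝ (q i).1 x)) := fun i x =>
    ((continuous_fst.tendsto _).comp (hq i)).inner tendsto_const_nhds
  have hsnd : ∀ i, Filter.Tendsto (fun R => (p R i).2) (Filter.hyperfilter ℕ)
      (nhds (q i).2) := fun i => (continuous_snd.tendsto _).comp (hq i)
  have hle : ∀ i, ∀ x ∈ interior M, inner ℝ (q i).1 x ≤ (q i).2 := fun i x hx =>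
    le_of_tendsto_of_tendsto' (hinner i x) (hsnd i) fun R => ((hp1 R i).2 x hx).le
  set Q := {x | ∀ i, inner ℝ (q i).1 x ≤ (q i).2} with hQ
  have hQconv : Convex ℝ Q := by
    rw [hQ, Set.ofPred_forall]
    exact convex_iInter fun i => convex_halfSpace_le (innerSL ℝ (q i).1).toLinearMap.isLinear _
  have hQclosed : IsClosed Q := by
    rw [hQ, Set.ofPred_forall]
    exact isClosed_iInter fun i => isClosed_le (by fun_prop) continuous_const
  have hMQ : M ⊆ Q := calc
    M ⊆ closure M := subset_closure
    _ = closure (interior M) := (hM.convex.closure_interior_eq_closure_of_nonempty_interior hne).symm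
    _ ⊆ Q := closure_minimal (fun x hx i => hle i x hx) hQclosed
  refine ⟨fun i => (q i).1, fun i => (q i).2, hM.maximal Q hQconv hMQ ?_⟩
  refine Set.Subset.antisymm (fun x hx => ⟨?_, hx.2⟩)
    (Set.inter_subset_inter_left _ (interior_mono hMQ))
  have hlt : ∀ i, inner ℝ (q i).1 x < (q i).2 := by
    intro i
    by_cases h0 : (q i).1 = 0
    · -- A halfspace that escapes to infinity has the limit `(0, 1)`.
      obtain ⟨c, hc⟩ := hne
      have h1 := hle i c hc
      have h2 : ‖q i‖ = 1 := by simpa using hq1 i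
      rw [h0, inner_zero_left] at h1 ⊢
      refine lt_of_le_of_ne h1 fun h3 => ?_
      rw [Prod.norm_def, h0, ← h3] at h2
      simp at h2
    · exact inner_lt_of_mem_interior h0 (fun y (hy : y ∈ Q) => hy i) hx.1
  have hev : ∀ᶠ R in (Filter.hyperfilter ℕ : Filter ℕ),
      (∀ i, inner ℝ (p R i).1 x < (p R i).2) ∧ ‖x‖ ≤ R₀ + R := by
    refine (Filter.eventually_all.2 fun i => (hinner i x).eventually_lt (hsnd i) (hlt i)).and ?_
    refine Filter.Eventually.filter_mono Nat.hyperfilter_le_atTop ?_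
    exact (Filter.tendsto_atTop_add_const_left _ R₀ tendsto_natCast_atTop_atTop).eventually_ge_atTop _
  obtain ⟨R, hR1, hR2⟩ := hev.exists
  exact hp2 R x hx.2 hR2 hR1

theorem IsMaximalConvex.numFacets_le {n : ℕ} {S M : Set (EuclideanSpace ℝ (Fin n))}
    (hS : IsDiscreteSubset S) {k t : ℕ} (h : HellyProperty S k t) (hM : IsMaximalConvex S k M) :
    numFacets M ≤ t := by
  obtain ⟨a, b, hab⟩ := hM.exists_description hS h
  rw [numFacets, if_pos ⟨t, a, b, hab⟩]
  exact encard_setOf_isFacet_le hab hM.full_dim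

/-! ### The quantitative Helly number -/

theorem IsMaximalConvex.numFacets_le_quantHelly {n : ℕ} {S M : Set (EuclideanSpace ℝ (Fin n))}
    (hS : IsDiscreteSubset S) {k : ℕ} (hM : IsMaximalConvex S k M) :
    (numFacets M : WithBot ℕ∞) ≤ quantHelly S k := by
  rw [quantHelly, if_pos ⟨interior M, hM.convex.interior, by
    rw [Set.inter_comm]; exact hM.card_interior⟩, WithBot.coe_le_coe]
  refine le_sInf ?_
  rintro _ ⟨t, ht, rfl⟩
  exact hM.numFacets_le hS ht

theorem exists_isMaximalConvex_of_quantHelly_ne_bot {n : ℕ} (hn : 1 ≤ n)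
    {S : Set (EuclideanSpace ℝ (Fin n))} (hS : IsDiscreteSubset S) {k : ℕ}
    (h : quantHelly S k ≠ ⊥) : ∃ M, IsMaximalConvex S k M := by
  rw [quantHelly] at h
  split_ifs at h with hex
  · obtain ⟨C, hC, hk⟩ := hex
    have hfin : (S ∩ C).Finite := Set.finite_of_encard_eq_coe hk
    have hcl : S ∩ convexHull ℝ (S ∩ C) = S ∩ C := hC.isHullClosed_inter
    obtain ⟨M, hM, -⟩ := hS.exists_isMaximalConvex hn (hfin.isCompact_convexHull ℝ)
      (convex_convexHull ℝ _) (by rw [hcl, hk])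
    exact ⟨M, hM⟩
  · exact absurd rfl h

theorem quantHelly_le_of_forall_numFacets_le {n : ℕ} (hn : 1 ≤ n)
    {S : Set (EuclideanSpace ℝ (Fin n))} (hS : IsDiscreteSubset S) {k t : ℕ}
    (ht : ∀ M, IsMaximalConvex S k M → numFacets M ≤ t) :
    quantHelly S k ≤ ((t : ℕ∞) : WithBot ℕ∞) := by
  rw [quantHelly]
  split_ifs
  · rw [WithBot.coe_le_coe]
    exact sInf_le ⟨t, hS.hellyProperty hn ht, rfl⟩
  · exact bot_le

theorem mainTheorem5 (n : ℕ) (hn : 1 ≤ n) (S : Set (EuclideanSpace ℝ (Fin n)))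
    (hS : IsDiscreteSubset S) (k : ℕ) :
    IsLUB {c : WithBot ℕ∞ | ∃ M : Set (EuclideanSpace ℝ (Fin n)),
        IsMaximalConvex S k M ∧ c = (numFacets M : WithBot ℕ∞)} (quantHelly S k) ∧
    (quantHelly S k ≠ ⊥ → quantHelly S k ≠ ⊤ →
      ∃ M : Set (EuclideanSpace ℝ (Fin n)),
        IsMaximalConvex S k M ∧ (numFacets M : WithBot ℕ∞) = quantHelly S k) ∧
    (quantHelly S k ≠ ⊤ →
      ∀ M : Set (EuclideanSpace ℝ (Fin n)), IsMaximalConvex S k M → IsPolyhedron M) := by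
  refine ⟨⟨?_, fun B hB => ?_⟩, fun hbot htop => ?_, fun htop M hM => ?_⟩
  · rintro _ ⟨M, hM, rfl⟩
    exact hM.numFacets_le_quantHelly hS
  · by_cases hbot : quantHelly S k = ⊥
    · rw [hbot]; exact bot_le
    obtain ⟨M₀, hM₀⟩ := exists_isMaximalConvex_of_quantHelly_ne_bot hn hS hbot
    induction B using WithBot.recBotCoe with
    | bot => exact absurd (hB ⟨M₀, hM₀, rfl⟩) (by simp)
    | coe b =>
      induction b using ENat.recTopCoe with
      | top => exact le_top
      | coe t =>
        exact quantHelly_le_of_forall_numFacets_le hn hS fun M hM =>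
          WithBot.coe_le_coe.1 (hB ⟨M, hM, rfl⟩)
  · obtain ⟨M₀, hM₀⟩ := exists_isMaximalConvex_of_quantHelly_ne_bot hn hS hbot
    have hle := fun M hM => IsMaximalConvex.numFacets_le_quantHelly (M := M) (k := k) hS hM
    by_contra! hne
    have hlt : ∀ M, IsMaximalConvex S k M → (numFacets M : WithBot ℕ∞) < quantHelly S k :=
      fun M hM => lt_of_le_of_ne (hle M hM) (hne M hM)
    obtain ⟨c, hc⟩ := WithBot.ne_bot_iff_exists.1 hbot
    induction c using ENat.recTopCoe with
    | top => exact htop hc.symm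
    | coe t =>
      simp only [← hc, WithBot.coe_lt_coe] at hlt
      obtain _ | t := t
      · exact not_lt_bot (hlt M₀ hM₀)
      · -- If the value `t + 1` were not attained, then `t` would be an upper bound as well.
        have := quantHelly_le_of_forall_numFacets_le (t := t) hn hS fun M hM =>
          ENat.lt_natCast_add_one_iff.1 (by exact_mod_cast hlt M hM)
        rw [← hc, WithBot.coe_le_coe] at this
        norm_cast at this
        omega
  · by_contra hpoly
    have := hM.numFacets_le_quantHelly hS
    rw [numFacets, if_neg hpoly] at this
    exact htop (top_le_iff.1 this)
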